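/- An edge-signed graph $G=(V,E^+,E^-)$ consists of a finite set $V=V(G)$ of vertices and two disjoint sets $E^+,E^-$ of $2$-subsets of $V$; its underlying graph is $(V,E^+\cup E^-)$, and $G$ is connected if its underlying graph is. Its adjacency matrix $A(G)$ is the symmetric matrix indexed by $V$ with $A(G)_{uw}=1$ if $\{u,w\}\in E^+$, $A(G)_{uw}=-1$ if $\{u,w\}\in E^-$, and $A(G)_{uw}=0$ otherwise. For $v\in V$, let $\hat A(G,v)$ be the matrix obtained from $A(G)$ by putting $-1$ in the diagonal position corresponding to $v$. Write $\lambda_1(M)$ for the smallest eigenvalue of a real symmetric matrix $M$, and $\lambda_1(G)=\lambda_1(A(G))$. An end-edge of a tree is an edge one of whose end-vertices has valency $1$. **Theorem.** Let $G$ be a connected edge-signed graph with $\lambda_1(G)>-2$, and let $v\in V(G)$. Then $\lambda_1(G)>\lambda_1(\hat A(G,v))$. Furthermore, $\lambda_1(\hat A(G,v))>-2$ if and only if the underlying graph of $G$ is (isomorphic to) the line graph of a finite tree $T$ in such a way that $v$ corresponds to an end-edge of $T$. Otherwise, $\lambda_1(\hat A(G,v))\leqslant-2$. -/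

import Mathlib

/-- An edge-signed graph with vertex set `V`: a set of `(+)`-edges and a set of `(-)`-edges
(both consisting of 2-subsets of `V`), with no pair being an edge of both signs. -/
structure EdgeSignedGraph (V : Type*) where
  /-- the graph formed by the `(+)`-edges -/
  pos : SimpleGraph V
  /-- the graph formed by the `(-)`-edges -/
  neg : SimpleGraph V
  disjoint_edgeSet : Disjoint pos.edgeSet neg.edgeSet

namespace EdgeSignedGraph

variable {V : Type*}

/-- The underlying (unsigned) graph, with edge set `E⁺ ∪ E⁻`. -/
def underlying (G : EdgeSignedGraph V) : SimpleGraph V := G.pos ⊔ G.neg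

open Classical in
/-- The signed adjacency matrix. -/
noncomputable def adjMatrix (G : EdgeSignedGraph V) : Matrix V V ℝ :=
  Matrix.of fun u w => if G.pos.Adj u w then 1 else if G.neg.Adj u w then -1 else 0

open Classical in
/-- The modified adjacency matrix `Â(G, v)`: the adjacency matrix with the diagonal entry at `v`
replaced by `-1`. -/
noncomputable def modAdjMatrix (G : EdgeSignedGraph V) (v : V) : Matrix V V ℝ :=
  Matrix.of fun u w => if u = v ∧ w = v then -1 else G.adjMatrix u w

theorem adjMatrix_isHermitian (G : EdgeSignedGraph V) : G.adjMatrix.IsHermitian := by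
  ext u w
  have h₁ := G.pos.adj_comm u w
  have h₂ := G.neg.adj_comm u w
  by_cases hp : G.pos.Adj u w <;> by_cases hn : G.neg.Adj u w <;> simp_all [adjMatrix]

theorem modAdjMatrix_isHermitian (G : EdgeSignedGraph V) (v : V) :
    (G.modAdjMatrix v).IsHermitian := by
  ext u w
  have h := G.adjMatrix_isHermitian.apply u w
  by_cases hu : u = v <;> by_cases hw : w = v <;> simp_all [modAdjMatrix]

end EdgeSignedGraph

/-- The smallest (real) eigenvalue `λ₁(A)` of a square matrix. For a real symmetric matrix of
positive size this is a genuine minimum, see `isLeast_smallestEigenvalue`. -/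
noncomputable def smallestEigenvalue {V : Type*} [Fintype V] (A : Matrix V V ℝ) : ℝ :=
  sInf {μ : ℝ | Module.End.HasEigenvalue A.mulVecLin μ}

theorem isLeast_smallestEigenvalue {V : Type*} [Fintype V] [Nonempty V] {A : Matrix V V ℝ}
    (hA : A.IsHermitian) :
    IsLeast {μ : ℝ | Module.End.HasEigenvalue A.mulVecLin μ} (smallestEigenvalue A) := by
  classical
  have h : {μ : ℝ | Module.End.HasEigenvalue A.mulVecLin μ} = Set.range hA.eigenvalues := by
    rw [← hA.spectrum_real_eq_range_eigenvalues, ← Matrix.spectrum_toLin']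
    ext μ
    exact Module.End.hasEigenvalue_iff_mem_spectrum
  unfold smallestEigenvalue
  rw [h]
  exact ⟨(Set.range_nonempty _).csInf_mem (Set.finite_range _),
    fun x hx => csInf_le (Set.finite_range _).bddBelow hx⟩

/-- An end-edge of a graph `T`: an edge one of whose end-vertices has valency `1`. -/
def SimpleGraph.IsEndEdge {W : Type*} (T : SimpleGraph W) (e : T.edgeSet) : Prop :=
  ∃ w ∈ (e : Sym2 W), (T.neighborSet w).ncard = 1

/-- `H` is (isomorphic to) the line graph of some finite tree `T`, in such a way that the
vertex `v` of `H` corresponds to an end-edge of `T`. -/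
def SimpleGraph.IsTreeLineGraphAtEndEdge {V : Type*} (H : SimpleGraph V) (v : V) : Prop :=
  ∃ (W : Type) (_ : Finite W) (T : SimpleGraph W),
    T.IsTree ∧ ∃ φ : H ≃g T.lineGraph, T.IsEndEdge (φ v)

open Matrix

/-! Everything rests on Gram factorizations of `Â + 2I`. If the underlying graph is the line graph
of a tree with `v` an end-edge, root the tree at the leaf on `v`. After switching, and because
triangles are positive, `Â + 2I = BᵀB` with `B` the signed incidence matrix without the root row
(`incMatrix_transpose_mul_self`). This square `B` is injective, so `λ₁(Â) > -2`.

Conversely, if `Â + 2I` is positive definite, it is the Gram matrix of independent vectors with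
integer products, of norm 1 at `v` and norm 2 elsewhere. In the lattice they generate, unit vectors
are equal, opposite or orthogonal. Starting from `v`, connectivity splits every other vector into
two orthogonal unit vectors, so vertices become edges between unit lines. A count of lines shows
that these edges form a tree (`isTreeLineGraphAtEndEdge_of_gram`).

Strictness needs proof only in the tree case, where a Perron-type argument on the grounded Laplacian
`BBᵀ` treats eigenvectors vanishing at `v` (`smallestEigenvalue_modAdjMatrix_lt`). -/

/-! ### Rayleigh bounds for the smallest eigenvalue. -/

theorem smallestEigenvalue_mul_le {V : Type*} [Fintype V] {A : Matrix V V ℝ}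
    (hA : A.IsHermitian) (x : V → ℝ) :
    smallestEigenvalue A * (x ⬝ᵥ x) ≤ x ⬝ᵥ (A *ᵥ x) := by
  classical
  rcases isEmpty_or_nonempty V with hV | hV
  · simp [dotProduct]
  set c := smallestEigenvalue A with hc
  have hB : (A - c • (1 : Matrix V V ℝ)).IsHermitian :=
    hA.sub (by simp [Matrix.IsHermitian])
  have hp : (A - c • (1 : Matrix V V ℝ)).PosSemidef := by
    rw [hB.posSemidef_iff_eigenvalues_nonneg]
    intro i
    have hv := hB.mulVec_eigenvectorBasis i
    have hne : (hB.eigenvectorBasis i : V → ℝ) ≠ 0 := by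
      intro h0
      have := (hB.eigenvectorBasis).orthonormal.ne_zero i
      exact this (by ext j; exact congrFun h0 j)
    have he : Module.End.HasEigenvalue A.mulVecLin (c + hB.eigenvalues i) := by
      refine Module.End.hasEigenvalue_of_hasEigenvector
        (x := (hB.eigenvectorBasis i : V → ℝ)) ⟨?_, hne⟩
      rw [Module.End.mem_eigenspace_iff, Matrix.mulVecLin_apply]
      rw [Matrix.sub_mulVec, Matrix.smul_mulVec, Matrix.one_mulVec, sub_eq_iff_eq_add] at hv
      rw [hv, add_smul, add_comm]
    have := (isLeast_smallestEigenvalue hA).2 he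
    simp only [← hc, Pi.zero_apply] at this ⊢
    linarith
  have := hp.dotProduct_mulVec_nonneg x
  rw [Matrix.sub_mulVec, Matrix.smul_mulVec, Matrix.one_mulVec, dotProduct_sub,
    dotProduct_smul, star_trivial, smul_eq_mul] at this
  linarith

theorem exists_eigenvector_smallestEigenvalue {V : Type*} [Fintype V] [Nonempty V]
    {A : Matrix V V ℝ} (hA : A.IsHermitian) :
    ∃ x : V → ℝ, x ≠ 0 ∧ A *ᵥ x = smallestEigenvalue A • x := by
  obtain ⟨x, hx⟩ := (isLeast_smallestEigenvalue hA).1.exists_hasEigenvector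
  exact ⟨x, hx.2, by simpa using hx.apply_eq_smul⟩

theorem dotProduct_self_pos_of_ne_zero {V : Type*} [Fintype V] {x : V → ℝ} (hx : x ≠ 0) :
    0 < x ⬝ᵥ x :=
  lt_of_le_of_ne (by simpa using dotProduct_star_self_nonneg x)
    fun h => hx (dotProduct_self_eq_zero.1 h.symm)

theorem lt_smallestEigenvalue_iff {V : Type*} [Fintype V] [Nonempty V] {A : Matrix V V ℝ}
    (hA : A.IsHermitian) (c : ℝ) :
    c < smallestEigenvalue A ↔ ∀ x : V → ℝ, x ≠ 0 → c * (x ⬝ᵥ x) < x ⬝ᵥ (A *ᵥ x) := by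
  constructor
  · intro h x hx
    exact (mul_lt_mul_of_pos_right h (dotProduct_self_pos_of_ne_zero hx)).trans_le
      (smallestEigenvalue_mul_le hA x)
  · intro h
    obtain ⟨x, hx, he⟩ := exists_eigenvector_smallestEigenvalue hA
    have := h x hx
    rw [he, dotProduct_smul, smul_eq_mul] at this
    exact lt_of_mul_lt_mul_right this (dotProduct_self_pos_of_ne_zero hx).le

/-! ### Entries and quadratic forms of the two matrices. -/

namespace EdgeSignedGraph

variable {V : Type*}

theorem adjMatrix_symm (G : EdgeSignedGraph V) (u w : V) :
    G.adjMatrix u w = G.adjMatrix w u := by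
  simpa using G.adjMatrix_isHermitian.apply w u

theorem adjMatrix_self (G : EdgeSignedGraph V) (u : V) : G.adjMatrix u u = 0 := by
  simp [adjMatrix]

theorem adjMatrix_of_adj {G : EdgeSignedGraph V} {u w : V} (h : G.underlying.Adj u w) :
    G.adjMatrix u w = 1 ∨ G.adjMatrix u w = -1 := by
  by_cases hp : G.pos.Adj u w
  · simp [adjMatrix, hp]
  · have hn : G.neg.Adj u w := by simpa [underlying, hp] using h
    simp [adjMatrix, hp, hn]

theorem adjMatrix_of_not_adj {G : EdgeSignedGraph V} {u w : V} (h : ¬ G.underlying.Adj u w) :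
    G.adjMatrix u w = 0 := by
  simp only [underlying, SimpleGraph.sup_adj, not_or] at h
  simp [adjMatrix, h.1, h.2]

theorem adjMatrix_ne_zero_iff {G : EdgeSignedGraph V} {u w : V} :
    G.adjMatrix u w ≠ 0 ↔ G.underlying.Adj u w := by
  refine ⟨fun h => not_imp_comm.1 adjMatrix_of_not_adj h, fun h => ?_⟩
  rcases adjMatrix_of_adj h with h | h <;> norm_num [h]

theorem exists_int_adjMatrix (G : EdgeSignedGraph V) (u w : V) :
    ∃ k : ℤ, G.adjMatrix u w = k := by
  by_cases h : G.underlying.Adj u w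
  · rcases adjMatrix_of_adj h with h | h
    · exact ⟨1, by simp [h]⟩
    · exact ⟨-1, by simp [h]⟩
  · exact ⟨0, by simp [adjMatrix_of_not_adj h]⟩

theorem modAdjMatrix_mulVec [Fintype V] [DecidableEq V] (G : EdgeSignedGraph V) (v : V)
    (x : V → ℝ) : G.modAdjMatrix v *ᵥ x = G.adjMatrix *ᵥ x - Pi.single v (x v) := by
  have h : G.modAdjMatrix v = G.adjMatrix - Matrix.single v v 1 := by
    ext u w
    by_cases hu : u = v
    · by_cases hw : w = v
      · subst hu hw
        simp [modAdjMatrix, adjMatrix_self]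
      · have : ¬ v = w := fun h => hw h.symm
        simp [modAdjMatrix, hw, this]
    · have : ¬ v = u := fun h => hu h.symm
      simp [modAdjMatrix, hu, this]
  rw [h, Matrix.sub_mulVec]
  ext u
  by_cases hu : u = v
  · subst hu
    simp [Matrix.mulVec, dotProduct, Matrix.single_apply]
  · have : ¬ v = u := fun h => hu h.symm
    simp [Matrix.mulVec, dotProduct, this, hu]

theorem dotProduct_modAdjMatrix_mulVec [Fintype V] (G : EdgeSignedGraph V) (v : V)
    (x : V → ℝ) :
    x ⬝ᵥ (G.modAdjMatrix v *ᵥ x) = x ⬝ᵥ (G.adjMatrix *ᵥ x) - x v * x v := by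
  classical
  rw [modAdjMatrix_mulVec, dotProduct_sub, dotProduct_single]

end EdgeSignedGraph

/-! ### Rooted trees, switching and the incidence factorization. -/

/-- `p` assigns to every vertex of `H` its parent with respect to the root `v`, the root being its
own parent, `d` is a depth function, and two distinct vertices are adjacent in `H` when one is the
parent of the other or they have the same parent. A vertex of `H` thus stands for an edge of a tree,
rooted at a leaf on the edge `v`. -/
structure SimpleGraph.IsParentMap {V : Type*} (H : SimpleGraph V) (v : V) (p : V → V)
    (d : V → ℕ) : Prop where
  root : p v = v
  depth_lt : ∀ u, u ≠ v → d (p u) < d u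
  adj_iff : ∀ u w, H.Adj u w ↔ u ≠ w ∧ (p u = w ∨ p w = u ∨ p u = p w)

namespace SimpleGraph.IsParentMap

variable {V : Type*} {H : SimpleGraph V} {v : V} {p : V → V} {d : V → ℕ}

theorem ne_parent (h : H.IsParentMap v p d) {u : V} (hu : u ≠ v) : u ≠ p u := by
  intro he
  have := h.depth_lt u hu
  rw [← he] at this
  exact this.false

theorem adj_parent (h : H.IsParentMap v p d) {u : V} (hu : u ≠ v) : H.Adj u (p u) :=
  (h.adj_iff _ _).2 ⟨h.ne_parent hu, Or.inl rfl⟩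

end SimpleGraph.IsParentMap

namespace EdgeSignedGraph

variable {V : Type*} {G : EdgeSignedGraph V} {v : V} {p : V → V} {d : V → ℕ}

/-- Parent edges form a tree, so signs can be propagated down from the root by recursion on depth.
The minus sign matches a column of the form `e_u - e_{p u}`. -/
theorem exists_switching (G : EdgeSignedGraph V) (h : G.underlying.IsParentMap v p d) :
    ∃ s : V → ℝ, (∀ u, s u = 1 ∨ s u = -1) ∧
      ∀ u, u ≠ v → G.adjMatrix u (p u) = -(s u * s (p u)) := by
  classical
  let F : ∀ u, (∀ w, (measure d).rel w u → ℝ) → ℝ := fun u ih =>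
    if hu : u = v then 1 else -G.adjMatrix u (p u) * ih (p u) (h.depth_lt u hu)
  let s : V → ℝ := (measure d).wf.fix F
  have hs : ∀ u, u ≠ v → s u = -G.adjMatrix u (p u) * s (p u) := by
    intro u hu
    have : s u = F u fun w _ => s w := (measure d).wf.fix_eq F u
    rw [this]
    simp [F, hu]
  have hv : s v = 1 := by
    have : s v = F v fun w _ => s w := (measure d).wf.fix_eq F v
    rw [this]
    simp [F]
  have h1 : ∀ u, s u = 1 ∨ s u = -1 := by
    intro u
    induction u using (measure d).wf.induction with
    | _ u ih =>
      by_cases hu : u = v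
      · exact Or.inl (hu ▸ hv)
      · rw [hs u hu]
        rcases adjMatrix_of_adj (h.adj_parent hu) with ha | ha <;>
          rcases ih (p u) (h.depth_lt u hu) with hp | hp <;> simp [ha, hp]
  refine ⟨s, h1, fun u hu => ?_⟩
  rw [hs u hu]
  rcases h1 (p u) with hp | hp <;> simp [hp]

/-- In an edge-signed graph with smallest eigenvalue greater than `-2` every triangle is
positive. -/
theorem adjMatrix_triangle [Fintype V] (hG : -2 < smallestEigenvalue G.adjMatrix) {a b c : V}
    (hab : G.underlying.Adj a b) (hac : G.underlying.Adj a c) (hbc : G.underlying.Adj b c) :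
    G.adjMatrix a b = G.adjMatrix a c * G.adjMatrix b c := by
  classical
  have : Nonempty V := ⟨a⟩
  set α := G.adjMatrix a c with hα
  set β := G.adjMatrix b c with hβ
  -- On a negative triangle this vector has Rayleigh quotient exactly `-2`.
  let x : V → ℝ := Pi.single a (-α) + Pi.single b (-β) + Pi.single c 1
  have hx : x ≠ 0 := by
    intro h0
    have := congrFun h0 c
    simp [x, hac.ne', hbc.ne'] at this
  have := (lt_smallestEigenvalue_iff G.adjMatrix_isHermitian _).1 hG x hx
  have hba := G.adjMatrix_symm b a
  have hca := G.adjMatrix_symm c a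
  have hcb := G.adjMatrix_symm c b
  simp only [x, mulVec_add, add_dotProduct, dotProduct_add, single_dotProduct, mulVec_single,
    Pi.single_apply, Pi.smul_apply, Matrix.col_apply, adjMatrix_self, hba, hca, hcb, ← hα, ← hβ,
    MulOpposite.smul_eq_mul_unop, MulOpposite.unop_op, if_true, hab.ne, hab.ne', hac.ne, hac.ne',
    hbc.ne, hbc.ne', if_false] at this
  rcases adjMatrix_of_adj hab with h1 | h1 <;> rcases adjMatrix_of_adj hac with h2 | h2 <;>
    rcases adjMatrix_of_adj hbc with h3 | h3 <;> rw [← hα] at h2 <;> rw [← hβ] at h3 <;>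
    rw [h1, h2, h3] at this ⊢ <;> first | (norm_num; done) | norm_num at this

open Classical in
/-- The signed incidence matrix of the tree described by a parent map, with the row of the root leaf
deleted. -/
noncomputable def incMatrix (v : V) (p : V → V) (s : V → ℝ) : Matrix V V ℝ :=
  Matrix.of fun i j => s j * ((if i = j then 1 else 0) -
    (if j = v then 0 else 1) * (if i = p j then 1 else 0))

open Classical in
theorem incMatrix_transpose_mulVec [Fintype V] (s y : V → ℝ) (j : V) :
    ((incMatrix v p s)ᵀ *ᵥ y) j = s j * (y j - (if j = v then 0 else 1) * y (p j)) := by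
  simp [incMatrix, Matrix.mulVec, dotProduct, sub_mul, mul_sub, Finset.sum_sub_distrib]

open Classical in
-- Columns are `±(e_j - e_{p j})`, except `±e_v` at the root, which gives the diagonal `2`, with `1`
-- at `v`. Off the diagonal, parent-child signs agree by the choice of `s`; sibling signs then
-- follow from the positive triangle with the common parent.
theorem incMatrix_transpose_mul_self [Fintype V] (hG : -2 < smallestEigenvalue G.adjMatrix)
    (h : G.underlying.IsParentMap v p d) {s : V → ℝ}
    (hs : ∀ u, s u = 1 ∨ s u = -1) (hs' : ∀ u, u ≠ v → G.adjMatrix u (p u) = -(s u * s (p u))) :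
    (incMatrix v p s)ᵀ * incMatrix v p s = G.modAdjMatrix v + (2 : ℝ) • (1 : Matrix V V ℝ) := by
  have hss : ∀ u, s u * s u = 1 := fun u => by rcases hs u with h | h <;> simp [h]
  ext j k
  have hjk : ((incMatrix v p s)ᵀ * incMatrix v p s) j k =
      s j * (incMatrix v p s j k - (if j = v then 0 else 1) * incMatrix v p s (p j) k) :=
    incMatrix_transpose_mulVec s (fun i => incMatrix v p s i k) j
  rw [hjk]
  have hdv := h.depth_lt
  by_cases hj : j = k
  · subst hj
    by_cases hjv : j = v
    · subst hjv
      simp [incMatrix, modAdjMatrix, hss]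
      norm_num
    · have := h.ne_parent hjv
      simp [incMatrix, modAdjMatrix, hjv, this, this.symm, adjMatrix_self]
      linear_combination 2 * hss j
  · have hA : (G.modAdjMatrix v + (2 : ℝ) • (1 : Matrix V V ℝ)) j k = G.adjMatrix j k := by
      have : ¬ (j = v ∧ k = v) := fun h => hj (h.1.trans h.2.symm)
      simp [modAdjMatrix, this, hj]
    rw [hA]
    by_cases hadj : G.underlying.Adj j k
    · rcases ((h.adj_iff j k).1 hadj).2 with he | he | he
      · have hjv : j ≠ v := by
          rintro rfl
          exact hj (h.root.symm.trans he)
        have h1 := hs' j hjv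
        have h2 : ¬ (k ≠ v ∧ j = p k) := by
          rintro ⟨hk, rfl⟩
          have a := hdv _ hk
          have b := hdv _ hjv
          rw [he] at b
          omega
        have h3 : ¬ (k ≠ v ∧ k = p k) := fun h' => h.ne_parent h'.1 h'.2
        subst he
        rw [h1]
        by_cases hk : p j = v
        · simp [incMatrix, hjv, hk]
        · have h2' : ¬ j = p (p j) := fun h' => h2 ⟨hk, h'⟩
          have h3' : ¬ p j = p (p j) := fun h' => h3 ⟨hk, h'⟩
          simp [incMatrix, hjv, hj, h2', h3']
      · have hkv : k ≠ v := by
          rintro rfl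
          exact hj (he.symm.trans h.root)
        have h1 := hs' k hkv
        rw [G.adjMatrix_symm j k]
        subst he
        rw [h1]
        by_cases hk : p k = v
        · simp [incMatrix, hkv, hk]
          rw [hk] at hj
          simp [hj]
          ring
        · have h2 := h.ne_parent hk
          have h3 : ¬ p (p k) = k := by
            intro h'
            have a := hdv _ hkv
            have b := hdv _ hk
            rw [h'] at b
            omega
          simp [incMatrix, hkv, hk, hj, h2.symm, h3]
          ring
      -- Since `p v = v`, a vertex sharing its parent with the root is really a child of the root.
      · by_cases hjv : j = v
        · subst hjv
          rw [h.root] at he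
          have hkj : k ≠ j := fun h => hj h.symm
          have h1 := hs' k hkj
          rw [← he] at h1
          rw [G.adjMatrix_symm, h1]
          simp [incMatrix, hj, hkj, ← he]
          ring
        by_cases hkv : k = v
        · subst hkv
          rw [h.root] at he
          have h1 := hs' j hjv
          rw [he] at h1
          rw [h1]
          simp [incMatrix, hj, he]
        have h1 := hs' j hjv
        have h2 := hs' k hkv
        have h3 := adjMatrix_triangle hG hadj (h.adj_parent hjv) (he ▸ h.adj_parent hkv)
        rw [he] at h1 h3
        rw [h3, h1, h2]
        have h4 := h.ne_parent hkv
        have h5 := h.ne_parent hjv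
        rw [he] at h5
        simp [incMatrix, hj, hjv, hkv, he, h4.symm, h5]
        linear_combination - s j * s k * hss (p k)
    · rw [adjMatrix_of_not_adj hadj]
      have := mt (h.adj_iff j k).2 hadj
      push Not at this
      obtain ⟨h1, h2, h3⟩ := this hj
      simp [incMatrix, hj, h1, h2.symm, h3]

/-- The matrix is triangular in order of depth: off the diagonal, row `i` is supported on children
of `i`, so at a deepest point of the support only the diagonal term survives. -/
theorem incMatrix_mulVec_injective [Fintype V] (h : G.underlying.IsParentMap v p d) {s : V → ℝ}
    (hs : ∀ u, s u = 1 ∨ s u = -1) {x : V → ℝ} (hx : incMatrix v p s *ᵥ x = 0) : x = 0 := by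
  classical
  by_contra hne
  have hS : (Finset.univ.filter fun u => x u ≠ 0).Nonempty := by
    by_contra hS
    simp only [Finset.not_nonempty_iff_eq_empty, Finset.filter_eq_empty_iff, Finset.mem_univ,
      true_implies, not_not] at hS
    exact hne (funext hS)
  obtain ⟨i, hi, hmax⟩ := Finset.exists_max_image _ d hS
  simp only [Finset.mem_filter, Finset.mem_univ, true_and] at hi hmax
  have h0 := congrFun hx i
  rw [mulVec, dotProduct, Finset.sum_eq_single i] at h0
  · have hii : incMatrix v p s i i = s i := by
      by_cases hiv : i = v
      · simp [incMatrix, hiv]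
      · simp [incMatrix, h.ne_parent hiv]
    rw [hii] at h0
    rcases hs i with h1 | h1 <;> simp [h1, hi] at h0
  · intro j _ hji
    by_cases hxj : x j = 0
    · simp [hxj]
    have : ¬ (j ≠ v ∧ i = p j) := by
      rintro ⟨h1, rfl⟩
      exact absurd (h.depth_lt j h1) (not_lt.2 (hmax j hxj))
    by_cases hjv : j = v
    · simp [incMatrix, hjv, hjv ▸ hji.symm]
    · have h2 : i ≠ p j := fun h => this ⟨hjv, h⟩
      simp [incMatrix, hji.symm, h2]
  · simp

end EdgeSignedGraph

/-! ### Spectral consequences of the factorization. -/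

namespace EdgeSignedGraph

variable {V : Type*} {G : EdgeSignedGraph V} {v : V} {p : V → V} {d : V → ℕ}

theorem incMatrix_mulVec_dotProduct_self [Fintype V] (hG : -2 < smallestEigenvalue G.adjMatrix)
    (h : G.underlying.IsParentMap v p d) {s : V → ℝ} (hs : ∀ u, s u = 1 ∨ s u = -1)
    (hs' : ∀ u, u ≠ v → G.adjMatrix u (p u) = -(s u * s (p u))) (x : V → ℝ) :
    (incMatrix v p s *ᵥ x) ⬝ᵥ (incMatrix v p s *ᵥ x) =
      x ⬝ᵥ (G.modAdjMatrix v *ᵥ x) + 2 * (x ⬝ᵥ x) := by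
  classical
  have := incMatrix_transpose_mul_self hG h hs hs'
  rw [← vecMul_transpose, ← dotProduct_mulVec, vecMul_transpose, mulVec_mulVec, this, add_mulVec,
    dotProduct_add, smul_mulVec, dotProduct_smul, one_mulVec, smul_eq_mul]

theorem neg_two_lt_smallestEigenvalue_modAdjMatrix [Fintype V]
    (hG : -2 < smallestEigenvalue G.adjMatrix) (h : G.underlying.IsParentMap v p d) :
    -2 < smallestEigenvalue (G.modAdjMatrix v) := by
  have : Nonempty V := ⟨v⟩
  obtain ⟨s, hs, hs'⟩ := G.exists_switching h
  rw [lt_smallestEigenvalue_iff (G.modAdjMatrix_isHermitian v)]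
  intro x hx
  have h1 := incMatrix_mulVec_dotProduct_self hG h hs hs' x
  have h2 := dotProduct_self_pos_of_ne_zero (mt (incMatrix_mulVec_injective h hs) hx)
  linarith

/-- Expand `|Mz - μz|² ≥ 0`. With `M = BᵀB` this carries a lower spectral bound over to `BBᵀ`. -/
theorem _root_.Matrix.mul_dotProduct_mulVec_le {V : Type*} [Fintype V] (M : Matrix V V ℝ) {μ : ℝ}
    (hμ : 0 ≤ μ) (hM : ∀ z : V → ℝ, μ * (z ⬝ᵥ z) ≤ z ⬝ᵥ (M *ᵥ z)) (z : V → ℝ) :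
    μ * (z ⬝ᵥ (M *ᵥ z)) ≤ (M *ᵥ z) ⬝ᵥ (M *ᵥ z) := by
  have h1 : 0 ≤ (M *ᵥ z - μ • z) ⬝ᵥ (M *ᵥ z - μ • z) := by
    simpa using dotProduct_star_self_nonneg (M *ᵥ z - μ • z)
  simp only [sub_dotProduct, dotProduct_sub, smul_dotProduct, dotProduct_smul, smul_eq_mul] at h1
  rw [dotProduct_comm (M *ᵥ z) z] at h1
  have h2 := mul_le_mul_of_nonneg_left (hM z) hμ
  linarith

/-- A minimal eigenvector `x` of `A` with `x v ≠ 0` has a smaller Rayleigh quotient for `Â`. If `x v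
= 0` and the inequality fails, `y = Bx` minimizes the form of `BBᵀ`, hence so does `|y|`; a
nonnegative null vector of `BBᵀ - μI` cannot vanish next to a nonzero value. -/
theorem smallestEigenvalue_modAdjMatrix_lt [Fintype V]
    (hG : -2 < smallestEigenvalue G.adjMatrix) (h : G.underlying.IsParentMap v p d) :
    smallestEigenvalue (G.modAdjMatrix v) < smallestEigenvalue G.adjMatrix := by
  classical
  have : Nonempty V := ⟨v⟩
  obtain ⟨s, hs, hs'⟩ := G.exists_switching h
  have hss : ∀ u, s u * s u = 1 := fun u => by rcases hs u with h | h <;> simp [h]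
  obtain ⟨x, hx, hAx⟩ := exists_eigenvector_smallestEigenvalue G.adjMatrix_isHermitian
  set lam := smallestEigenvalue G.adjMatrix with hlam
  have hmin := smallestEigenvalue_mul_le (G.modAdjMatrix_isHermitian v)
  have hxx := dotProduct_self_pos_of_ne_zero hx
  by_cases hxv : x v = 0
  swap
  · have h1 := hmin x
    rw [dotProduct_modAdjMatrix_mulVec, hAx, dotProduct_smul, smul_eq_mul] at h1
    have h2 : 0 < x v * x v := mul_self_pos.2 hxv
    exact lt_of_mul_lt_mul_right (by linarith) hxx.le
  by_contra hcon
  rw [not_lt] at hcon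
  set μ := lam + 2 with hμ
  have hμ0 : 0 < μ := by linarith
  set B := incMatrix v p s with hB
  have hBB : Bᵀ * B = _ := incMatrix_transpose_mul_self hG h hs hs'
  have hM : ∀ z : V → ℝ, (Bᵀ * B) *ᵥ z = G.modAdjMatrix v *ᵥ z + (2 : ℝ) • z := by
    intro z
    rw [hBB, add_mulVec, smul_mulVec, one_mulVec]
  have hMz : ∀ z : V → ℝ, μ * (z ⬝ᵥ z) ≤ z ⬝ᵥ ((Bᵀ * B) *ᵥ z) := by
    intro z
    rw [hM, dotProduct_add, dotProduct_smul, smul_eq_mul]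
    have h1 := hmin z
    have h2 : 0 ≤ z ⬝ᵥ z := by simpa using dotProduct_star_self_nonneg z
    have := mul_le_mul_of_nonneg_right hcon h2
    rw [hμ]
    linarith
  have hsurj : Function.Surjective B.mulVecLin :=
    LinearMap.injective_iff_surjective.1 ((injective_iff_map_eq_zero _).2 fun z hz =>
      incMatrix_mulVec_injective h hs hz)
  have hform : ∀ y : V → ℝ, y ⬝ᵥ ((B * Bᵀ - μ • (1 : Matrix V V ℝ)) *ᵥ y) =
      (Bᵀ *ᵥ y) ⬝ᵥ (Bᵀ *ᵥ y) - μ * (y ⬝ᵥ y) := by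
    intro y
    rw [sub_mulVec, dotProduct_sub, smul_mulVec, one_mulVec, dotProduct_smul, smul_eq_mul,
      ← mulVec_mulVec, dotProduct_mulVec, ← mulVec_transpose]
  have hN : (B * Bᵀ - μ • (1 : Matrix V V ℝ)).PosSemidef := by
    refine Matrix.PosSemidef.of_dotProduct_mulVec_nonneg ?_ fun y => ?_
    · have := (isHermitian_mul_conjTranspose_self B)
      rw [conjTranspose_eq_transpose_of_trivial] at this
      exact this.sub (by simp [Matrix.IsHermitian])
    · obtain ⟨z, rfl⟩ := hsurj y
      rw [star_trivial, hform, mulVecLin_apply, mulVec_mulVec]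
      have h1 := Matrix.mul_dotProduct_mulVec_le (Bᵀ * B) hμ0.le hMz z
      have h2 : (B *ᵥ z) ⬝ᵥ (B *ᵥ z) = z ⬝ᵥ ((Bᵀ * B) *ᵥ z) := by
        rw [← mulVec_mulVec, dotProduct_mulVec z, vecMul_transpose]
      rw [h2]
      linarith
  set y := B *ᵥ x with hy
  have hy0 : y ≠ 0 := mt (incMatrix_mulVec_injective h hs) hx
  have hBy : Bᵀ *ᵥ y = μ • x := by
    rw [hy, mulVec_mulVec, hM, modAdjMatrix_mulVec, hAx, hxv, Pi.single_zero, sub_zero, hμ,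
      add_smul]
  -- Column `v` of `B` has a single nonzero entry, so `(Bᵀy) v = ±y v`.
  have hyv : y v = 0 := by
    have := congrFun hBy v
    rw [hB, incMatrix_transpose_mulVec] at this
    rcases hs v with h1 | h1 <;> simpa [hxv, h1] using this
  have hyy : y ⬝ᵥ y = μ * (x ⬝ᵥ x) := by
    have h1 : y ⬝ᵥ y = (B *ᵥ x) ⬝ᵥ y := rfl
    rw [h1, ← vecMul_transpose, ← dotProduct_mulVec, hBy, dotProduct_smul, smul_eq_mul]
  let z : V → ℝ := fun i => |y i|
  have hzz : z ⬝ᵥ z = y ⬝ᵥ y := by simp [z, dotProduct]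
  have hz0 : (B * Bᵀ - μ • (1 : Matrix V V ℝ)) *ᵥ z = 0 := by
    rw [← hN.dotProduct_mulVec_zero_iff]
    refine le_antisymm ?_ (hN.dotProduct_mulVec_nonneg z)
    rw [star_trivial, hform, hzz]
    have h1 : (Bᵀ *ᵥ z) ⬝ᵥ (Bᵀ *ᵥ z) ≤ (Bᵀ *ᵥ y) ⬝ᵥ (Bᵀ *ᵥ y) := by
      refine Finset.sum_le_sum fun j _ => ?_
      rw [hB, incMatrix_transpose_mulVec, incMatrix_transpose_mulVec, mul_mul_mul_comm, hss,
        one_mul, mul_mul_mul_comm, hss, one_mul]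
      by_cases hj : j = v
      · simp [hj, z]
      · simp only [hj, if_false, one_mul, z]
        rw [← abs_mul_abs_self (y j - y (p j)), ← abs_mul_abs_self (|y j| - |y (p j)|)]
        exact mul_self_le_mul_self (abs_nonneg _) (abs_abs_sub_abs_le _ _)
    have h2 : (Bᵀ *ᵥ y) ⬝ᵥ (Bᵀ *ᵥ y) = μ * (y ⬝ᵥ y) := by
      rw [hBy, hyy, smul_dotProduct, dotProduct_smul, smul_eq_mul, smul_eq_mul]
    linarith
  -- Since `y` vanishes at the root but not everywhere, going down the tree it becomes nonzero
  -- somewhere.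
  obtain ⟨c, hcv, hc, hpc⟩ : ∃ c, c ≠ v ∧ y c ≠ 0 ∧ y (p c) = 0 := by
    by_contra hno
    push Not at hno
    refine hy0 (funext fun u => ?_)
    induction u using (measure d).wf.induction with
    | _ u ih =>
      by_cases hu : u = v
      · exact hu ▸ hyv
      · by_contra hyu
        exact hno u hu hyu (ih (p u) (h.depth_lt u hu))
  have h1 := congrFun hz0 (p c)
  rw [sub_mulVec, smul_mulVec, one_mulVec, ← mulVec_mulVec] at h1
  have hzp : z (p c) = 0 := by simp [z, hpc]
  simp only [Pi.sub_apply, Pi.smul_apply, smul_eq_mul, hzp, mul_zero, sub_zero,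
    Pi.zero_apply] at h1
  -- At a zero of `z ≥ 0` the Laplacian `BBᵀ` only subtracts neighbouring values, and strictly so
  -- for `c`.
  have hterm : ∀ j, B (p c) j * (Bᵀ *ᵥ z) j ≤ 0 := by
    intro j
    rw [hB, incMatrix_transpose_mulVec]
    simp only [incMatrix, Matrix.of_apply]
    rw [mul_mul_mul_comm, hss, one_mul]
    have hzj : 0 ≤ z j := abs_nonneg _
    have hzpj : 0 ≤ z (p j) := abs_nonneg _
    by_cases hjv : j = v
    · by_cases h2 : p c = v
      · subst hjv
        rw [h2] at hzp
        simp [hzp]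
      · simp [hjv, h2]
    · by_cases h2 : p c = j
      · rw [h2] at hzp
        simp [hjv, h2, hzp, h.ne_parent hjv, hzpj]
      · by_cases h3 : p c = p j
        · rw [h3] at hzp
          simp [hjv, h3, hzp]
          by_cases h4 : p j = j <;> simp [h4, hzj]
        · simp [hjv, h2, h3]
  have hlt : (B *ᵥ (Bᵀ *ᵥ z)) (p c) < 0 := by
    refine Finset.sum_neg' (fun j _ => hterm j) ⟨c, Finset.mem_univ _, ?_⟩
    rw [hB, incMatrix_transpose_mulVec]
    simp only [incMatrix, Matrix.of_apply]
    rw [mul_mul_mul_comm, hss, one_mul]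
    have : 0 < z c := abs_pos.2 hc
    simp [hcv, hzp, (h.ne_parent hcv).symm, this]
  exact hlt.ne h1

end EdgeSignedGraph

/-! ### Line graphs of trees: passing to parent maps, and recognition by counting. -/

namespace SimpleGraph

theorem Connected.exists_adj_dist_lt {W : Type*} {T : SimpleGraph W} (hT : T.Connected) {r i : W}
    (hi : i ≠ r) : ∃ j, T.Adj i j ∧ T.dist j r < T.dist i r := by
  obtain ⟨q, hq⟩ := hT.exists_walk_length_eq_dist i r
  cases q with
  | nil => exact absurd rfl hi
  | cons hadj q =>
    refine ⟨_, hadj, ?_⟩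
    have := dist_le q
    rw [Walk.length_cons] at hq
    omega

/-- In a rooted finite tree, every edge joins a unique vertex other than the root to its parent. -/
theorem IsTree.exists_parent {W : Type*} [Finite W] {T : SimpleGraph W} (hT : T.IsTree) (r : W) :
    ∃ π : W → W, (∀ i, i ≠ r → T.dist (π i) r < T.dist i r) ∧
      (∀ i, i ≠ r → T.Adj i (π i)) ∧ ∀ e ∈ T.edgeSet, ∃ i, i ≠ r ∧ e = s(i, π i) := by
  classical
  have := Fintype.ofFinite W
  have hex : ∀ i, ∃ j, i ≠ r → T.Adj i j ∧ T.dist j r < T.dist i r := by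
    intro i
    by_cases hi : i = r
    · exact ⟨i, fun h => absurd hi h⟩
    · obtain ⟨j, hj⟩ := hT.connected.exists_adj_dist_lt hi
      exact ⟨j, fun _ => hj⟩
  choose π hπ using hex
  refine ⟨π, fun i hi => (hπ i hi).2, fun i hi => (hπ i hi).1, ?_⟩
  let β : {i // i ≠ r} → T.edgeSet := fun i => ⟨s(i.1, π i.1), (hπ i.1 i.2).1⟩
  have hinj : Function.Injective β := by
    rintro ⟨i, hi⟩ ⟨j, hj⟩ hij
    have h1 : s(i, π i) = s(j, π j) := congrArg Subtype.val hij
    rcases Sym2.eq_iff.1 h1 with ⟨h, -⟩ | ⟨h, h'⟩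
    · exact Subtype.ext h
    · have a := (hπ i hi).2
      have b := (hπ j hj).2
      rw [h'] at a
      rw [← h] at b
      omega
  -- A tree has one edge fewer than vertices, so the injection from non-root vertices to edges is
  -- onto.
  have hcard : Nat.card {i // i ≠ r} = Nat.card T.edgeSet := by
    have h1 := (isTree_iff_connected_and_card.1 hT).2
    have h2 : Nat.card {i // i ≠ r} + 1 = Nat.card W := by
      rw [Nat.card_eq_fintype_card, Nat.card_eq_fintype_card, Fintype.card_subtype_compl,
        Fintype.card_subtype_eq]
      have := Fintype.card_pos_iff.2 ⟨r⟩
      omega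
    omega
  have hbij := (Nat.bijective_iff_injective_and_card β).2 ⟨hinj, hcard⟩
  intro e he
  obtain ⟨⟨i, hi⟩, h⟩ := hbij.2 ⟨e, he⟩
  exact ⟨i, hi, (congrArg Subtype.val h).symm⟩

/-- Root the tree at the valency-one end `r` of `v` and name each edge by its lower end `g u`; the
parent of an edge is the edge just above it. -/
theorem IsTreeLineGraphAtEndEdge.exists_isParentMap {V : Type*} {H : SimpleGraph V} {v : V}
    (h : H.IsTreeLineGraphAtEndEdge v) : ∃ p d, H.IsParentMap v p d := by
  obtain ⟨W, _, T, hT, φ, r, hr, hdeg⟩ := h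
  obtain ⟨π, hlt, hadj, hπ⟩ := hT.exists_parent r
  choose g hgr hg using fun u : V => hπ (φ u : Sym2 W) (φ u).2
  have hginj : Function.Injective g := by
    intro u w huw
    apply φ.injective
    apply Subtype.ext
    rw [hg u, hg w, huw]
  have hgsurj : ∀ i, i ≠ r → ∃ u, g u = i := by
    intro i hi
    obtain ⟨u, hu⟩ := φ.surjective ⟨s(i, π i), hadj i hi⟩
    refine ⟨u, ?_⟩
    have h1 : s(i, π i) = s(g u, π (g u)) := by rw [← hg u, hu]
    rcases Sym2.eq_iff.1 h1 with ⟨h, -⟩ | ⟨h, h'⟩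
    · exact h.symm
    · have a := hlt i hi
      have b := hlt (g u) (hgr u)
      rw [h'] at a
      rw [← h] at b
      omega
  -- The valency of `r` enters here: no edge other than `v` reaches the root.
  have hroot : ∀ u, π (g u) = r ↔ u = v := by
    obtain ⟨a, ha⟩ := Set.ncard_eq_one.1 hdeg
    have hv : π (g v) = r := by
      rw [hg v, Sym2.mem_iff] at hr
      rcases hr with h | h
      · exact absurd h.symm (hgr v)
      · exact h.symm
    refine fun u => ⟨fun hu => hginj ?_, fun hu => hu ▸ hv⟩
    have h1 : g u ∈ T.neighborSet r := by
      have := (hadj _ (hgr u)).symm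
      rwa [hu] at this
    have h2 : g v ∈ T.neighborSet r := by
      have := (hadj _ (hgr v)).symm
      rwa [hv] at this
    rw [ha, Set.mem_singleton_iff] at h1 h2
    rw [h1, h2]
  classical
  have hp : ∀ u, ∃ w, if u = v then w = v else g w = π (g u) := by
    intro u
    by_cases hu : u = v
    · exact ⟨v, by simp [hu]⟩
    · obtain ⟨w, hw⟩ := hgsurj (π (g u)) (mt (hroot u).1 hu)
      exact ⟨w, by simp [hu, hw]⟩
  choose p hp using hp
  have hpv : p v = v := by simpa using hp v
  have hpu : ∀ u, u ≠ v → g (p u) = π (g u) := fun u hu => by simpa [hu] using hp u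
  refine ⟨p, fun u => T.dist (g u) r, hpv, fun u hu => ?_, fun u w => ?_⟩
  · rw [hpu u hu]
    exact hlt _ (hgr u)
  · rw [← φ.map_adj_iff, lineGraph_adj_iff_exists, hg u, hg w, φ.injective.ne_iff]
    refine and_congr_right fun huw => ?_
    have h1 : ∀ a b, a ≠ b → (π (g a) = g b ↔ p a = b) := by
      intro a b hab
      by_cases ha : a = v
      · have := (hroot a).2 ha
        rw [this, ha, hpv]
        exact ⟨fun h => absurd h.symm (hgr b), fun h => absurd (ha.trans h) hab⟩
      · rw [← hpu a ha, hginj.eq_iff]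
    constructor
    · rintro ⟨k, hk1, hk2⟩
      rw [Sym2.mem_iff] at hk1 hk2
      rcases hk1 with rfl | rfl <;> rcases hk2 with hk | hk
      · exact absurd (hginj hk) huw
      · exact Or.inr (Or.inl ((h1 w u huw.symm).1 hk.symm))
      · exact Or.inl ((h1 u w huw).1 hk)
      · have hu : u ≠ v := by
          intro hu
          exact huw (hu.trans ((hroot w).1 (hk.symm.trans ((hroot u).2 hu))).symm)
        have hw : w ≠ v := by
          intro hw
          exact huw (((hroot u).1 (hk.trans ((hroot w).2 hw))).trans hw.symm)
        rw [← hpu u hu, ← hpu w hw, hginj.eq_iff] at hk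
        exact Or.inr (Or.inr hk)
    · rintro (h | h | h)
      · exact ⟨π (g u), Sym2.mem_mk_right _ _, by
          rw [(h1 u w huw).2 h]
          exact Sym2.mem_mk_left _ _⟩
      · exact ⟨g u, Sym2.mem_mk_left _ _, by
          rw [← (h1 w u huw.symm).2 h]
          exact Sym2.mem_mk_right _ _⟩
      · by_cases hu : u = v
        · subst hu
          rw [hpv] at h
          refine ⟨g u, Sym2.mem_mk_left _ _, ?_⟩
          rw [← (h1 w u huw.symm).2 h.symm]
          exact Sym2.mem_mk_right _ _
        by_cases hw : w = v
        · subst hw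
          rw [hpv] at h
          refine ⟨g w, ?_, Sym2.mem_mk_left _ _⟩
          rw [← (h1 u w huw).2 h]
          exact Sym2.mem_mk_right _ _
        refine ⟨π (g u), Sym2.mem_mk_right _ _, ?_⟩
        rw [← hpu u hu, h, hpu w hw]
        exact Sym2.mem_mk_right _ _

/-- A graph with `n` vertices, whose vertices are assigned pairs of elements of a set with at least
`n + 1` elements in such a way that vertices which are adjacent, and no others, have
pairs that meet, is the line graph of a tree. -/
theorem Connected.isTreeLineGraphAtEndEdge {V : Type*} [Finite V] {W : Type}
    {H : SimpleGraph V} (hH : H.Connected) {v : V} (ε : V → Sym2 W) (hdiag : ∀ u, ¬ (ε u).IsDiag)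
    (hadj : ∀ u w, H.Adj u w → ∃ k, k ∈ ε u ∧ k ∈ ε w)
    (hadj' : ∀ u w, ε u ≠ ε w → (∃ k, k ∈ ε u ∧ k ∈ ε w) → H.Adj u w)
    (hcov : ∀ k, ∃ u, k ∈ ε u) (hcard : Nat.card V + 1 ≤ Nat.card W) {r : W}
    (hr : ∀ u, r ∈ ε u ↔ u = v) : H.IsTreeLineGraphAtEndEdge v := by
  let T : SimpleGraph W := fromEdgeSet (Set.range ε)
  have hE : T.edgeSet = Set.range ε := by
    rw [edgeSet_fromEdgeSet, sdiff_eq_left, Set.disjoint_left]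
    rintro _ ⟨u, rfl⟩ hu
    exact hdiag u hu
  have hmem : ∀ u i j, i ∈ ε u → j ∈ ε u → T.Reachable i j := by
    intro u i j hi hj
    by_cases hij : i = j
    · exact hij ▸ Reachable.refl _
    · have : ε u = s(i, j) := ((Sym2.mem_and_mem_iff hij).1 ⟨hi, hj⟩)
      refine Adj.reachable ?_
      rw [← mem_edgeSet, hE]
      exact ⟨u, this⟩
  have hwalk : ∀ {u w : V}, H.Walk u w → ∀ i j, i ∈ ε u → j ∈ ε w → T.Reachable i j := by
    intro u w q
    induction q with
    | nil => exact hmem _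
    | cons hq q ih =>
      intro i j hi hj
      obtain ⟨k, hk1, hk2⟩ := hadj _ _ hq
      exact (hmem _ i k hi hk1).trans (ih k j hk2 hj)
  have hconn : T.Connected := by
    have : Nonempty W := ⟨r⟩
    refine ⟨fun i j => ?_⟩
    obtain ⟨u, hu⟩ := hcov i
    obtain ⟨w, hw⟩ := hcov j
    obtain ⟨q⟩ := hH.preconnected u w
    exact hwalk q i j hu hw
  let f : V → T.edgeSet := fun u => ⟨ε u, hE ▸ ⟨u, rfl⟩⟩
  have hf : Function.Surjective f := by
    rintro ⟨e, he⟩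
    obtain ⟨u, rfl⟩ := hE ▸ he
    exact ⟨u, rfl⟩
  have : Finite W := Nat.finite_of_card_ne_zero (by omega)
  -- The chain `|V| + 1 ≤ |W| ≤ |E| + 1 ≤ |V| + 1` collapses, so `T` is a tree and `ε` is injective.
  -- This excludes two vertices with the same pair, which `hadj'` leaves open.
  have h1 := hconn.card_vert_le_card_edgeSet_add_one
  have h2 := Nat.card_le_card_of_surjective f hf
  have hT : T.IsTree := isTree_iff_connected_and_card.2 ⟨hconn, by omega⟩
  have hbij : Function.Bijective f :=
    (Nat.bijective_iff_surjective_and_card f).2 ⟨hf, by omega⟩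
  refine ⟨W, this, T, hT, ⟨Equiv.ofBijective f hbij, ?_⟩, r, ?_, ?_⟩
  · intro u w
    rw [lineGraph_adj_iff_exists]
    change f u ≠ f w ∧ (∃ k, k ∈ ε u ∧ k ∈ ε w) ↔ _
    refine ⟨fun h => hadj' u w (fun he => h.1 (Subtype.ext he)) h.2, fun h => ⟨?_, hadj u w h⟩⟩
    exact hbij.1.ne h.ne
  · exact (hr v).2 rfl
  · obtain ⟨j, hj⟩ := (hr v).2 rfl
    rw [Set.ncard_eq_one]
    refine ⟨j, Set.ext fun k => ?_⟩
    rw [mem_neighborSet, ← mem_edgeSet, hE, Set.mem_singleton_iff]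
    constructor
    · rintro ⟨u, hu⟩
      have : u = v := (hr u).1 (hu ▸ Sym2.mem_mk_left _ _)
      rw [← this, hu] at hj
      exact Sym2.congr_right.1 hj
    · rintro rfl
      exact ⟨v, hj⟩

theorem _root_.Sym2.finite_of_forall_exists_mem {V W : Type*} [Finite V] (ε : V → Sym2 W)
    (hcov : ∀ k, ∃ u, k ∈ ε u) : Finite W := by
  have h : (⋃ u, {k | k ∈ ε u}).Finite := by
    refine Set.finite_iUnion fun u => ?_
    induction ε u with
    | _ a b =>
      refine (Set.toFinite {a, b}).subset fun k hk => ?_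
      simpa using hk
  refine Set.finite_univ_iff.1 (h.subset fun k _ => ?_)
  obtain ⟨u, hu⟩ := hcov k
  exact Set.mem_iUnion.2 ⟨u, hu⟩

end SimpleGraph

/-! ### Unit vectors in integral lattices. -/

theorem dotProduct_self_nonneg_real {n : ℕ} (y : Fin n → ℝ) : 0 ≤ y ⬝ᵥ y := by
  simpa using dotProduct_star_self_nonneg y

/-- The elements of norm `1` of a subgroup of `ℝⁿ`. -/
abbrev AddSubgroup.UnitVector {n : ℕ} (Z : AddSubgroup (Fin n → ℝ)) : Type :=
  {y : Fin n → ℝ // y ∈ Z ∧ y ⬝ᵥ y = 1}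

/-- Two unit vectors are equivalent if they are equal up to sign. -/
def AddSubgroup.unitVectorSetoid {n : ℕ} (Z : AddSubgroup (Fin n → ℝ)) :
    Setoid Z.UnitVector where
  r e f := f.1 = e.1 ∨ f.1 = -e.1
  iseqv :=
    { refl := fun _ => Or.inl rfl
      symm := by
        rintro e f (h | h)
        · exact Or.inl h.symm
        · exact Or.inr (by rw [h, neg_neg])
      trans := by
        rintro e f g (h | h) (h' | h') <;> simp [h, h'] }

/-- The lines spanned by the unit vectors in a subgroup of `ℝⁿ`. -/
abbrev AddSubgroup.UnitLine {n : ℕ} (Z : AddSubgroup (Fin n → ℝ)) : Type :=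
  Quotient Z.unitVectorSetoid

namespace AddSubgroup

variable {n : ℕ} {Z : AddSubgroup (Fin n → ℝ)}

/-- `y` is a unit vector spanning the line `q`; the zero vector spans the dummy line `none`. -/
def Spans (Z : AddSubgroup (Fin n → ℝ)) : Option Z.UnitLine → (Fin n → ℝ) → Prop
  | none, y => y = 0
  | some q, y => ∃ h : y ∈ Z ∧ y ⬝ᵥ y = 1, Quotient.mk _ ⟨y, h⟩ = q

/-- By Cauchy–Schwarz the integer product `k` satisfies `k² ≤ 2`. -/
theorem eq_zero_or_one_or_neg_one (hZ : ∀ y ∈ Z, ∀ z ∈ Z, ∃ k : ℤ, y ⬝ᵥ z = k)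
    {y e : Fin n → ℝ} (hy : y ∈ Z) (hyy : y ⬝ᵥ y ≤ 2) (he : e ∈ Z) (hee : e ⬝ᵥ e = 1) :
    y ⬝ᵥ e = 0 ∨ y ⬝ᵥ e = 1 ∨ y ⬝ᵥ e = -1 := by
  obtain ⟨k, hk⟩ := hZ y hy e he
  have h1 := dotProduct_self_nonneg_real (y - (k : ℝ) • e)
  simp only [sub_dotProduct, dotProduct_sub, smul_dotProduct, dotProduct_smul, smul_eq_mul] at h1
  rw [dotProduct_comm e y, hk, hee] at h1
  have h2 : (k : ℝ) * k ≤ 2 := by linarith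
  have h3 : k * k ≤ 2 := by exact_mod_cast h2
  have h4 : k ≤ 1 := by nlinarith
  have h5 : -1 ≤ k := by nlinarith
  have h6 : k = 0 ∨ k = 1 ∨ k = -1 := by omega
  rw [hk]
  exact_mod_cast h6

theorem eq_or_eq_neg_of_dotProduct_ne_zero (hZ : ∀ y ∈ Z, ∀ z ∈ Z, ∃ k : ℤ, y ⬝ᵥ z = k)
    {e f : Fin n → ℝ} (he : e ∈ Z) (hee : e ⬝ᵥ e = 1) (hf : f ∈ Z) (hff : f ⬝ᵥ f = 1)
    (h : e ⬝ᵥ f ≠ 0) : f = e ∨ f = -e := by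
  rcases (eq_zero_or_one_or_neg_one hZ he (by linarith) hf hff).resolve_left h with h | h
  · refine Or.inl (sub_eq_zero.1 (dotProduct_self_eq_zero.1 ?_))
    simp only [sub_dotProduct, dotProduct_sub]
    rw [dotProduct_comm f e, h, hee, hff]
    norm_num
  · refine Or.inr (eq_neg_iff_add_eq_zero.2 (dotProduct_self_eq_zero.1 ?_))
    simp only [add_dotProduct, dotProduct_add]
    rw [dotProduct_comm f e, h, hee, hff]
    norm_num

theorem Spans.dotProduct_eq_zero (hZ : ∀ y ∈ Z, ∀ z ∈ Z, ∃ k : ℤ, y ⬝ᵥ z = k)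
    {i j : Option Z.UnitLine} {a b : Fin n → ℝ} (ha : Z.Spans i a) (hb : Z.Spans j b)
    (hij : i ≠ j) : a ⬝ᵥ b = 0 := by
  rcases i with _ | q
  · rw [show a = 0 from ha, zero_dotProduct]
  rcases j with _ | q'
  · rw [show b = 0 from hb, dotProduct_zero]
  obtain ⟨ha, rfl⟩ := ha
  obtain ⟨hb, rfl⟩ := hb
  by_contra h
  exact hij (congrArg some (Quotient.sound
    (eq_or_eq_neg_of_dotProduct_ne_zero hZ ha.1 ha.2 hb.1 hb.2 h)))

theorem Spans.eq_or_eq_neg {q : Z.UnitLine} {a b : Fin n → ℝ} (ha : Z.Spans (some q) a)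
    (hb : Z.Spans (some q) b) : b = a ∨ b = -a := by
  obtain ⟨ha, rfl⟩ := ha
  obtain ⟨hb, h⟩ := hb
  exact Quotient.exact h.symm

theorem Spans.dotProduct_self {q : Z.UnitLine} {a : Fin n → ℝ} (ha : Z.Spans (some q) a) :
    a ⬝ᵥ a = 1 :=
  ha.1.2

theorem Spans.dotProduct_ne_zero {q : Z.UnitLine} {a b : Fin n → ℝ} (ha : Z.Spans (some q) a)
    (hb : Z.Spans (some q) b) : a ⬝ᵥ b ≠ 0 := by
  rcases ha.eq_or_eq_neg hb with rfl | rfl <;> simp [ha.dotProduct_self]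

theorem spans_mk {a : Fin n → ℝ} (ha : a ∈ Z ∧ a ⬝ᵥ a = 1) :
    Z.Spans (some (Quotient.mk _ ⟨a, ha⟩)) a :=
  ⟨ha, rfl⟩

theorem spans_out (q : Z.UnitLine) : Z.Spans (some q) q.out.1 :=
  ⟨q.out.2, Quotient.out_eq q⟩

end AddSubgroup

/-- If a root vector is not orthogonal to a unit vector then it is a sum of two orthogonal unit
vectors. -/
theorem AddSubgroup.exists_spans_add {n : ℕ} {Z : AddSubgroup (Fin n → ℝ)}
    (hZ : ∀ y ∈ Z, ∀ z ∈ Z, ∃ k : ℤ, y ⬝ᵥ z = k) {y a : Fin n → ℝ} (hy : y ∈ Z)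
    (hyy : y ⬝ᵥ y = 2) (ha : a ∈ Z) (haa : a ⬝ᵥ a = 1) (hya : y ⬝ᵥ a ≠ 0) :
    ∃ q q' : Z.UnitLine, q ≠ q' ∧ ∃ b c, Z.Spans (some q) b ∧ Z.Spans (some q') c ∧ y = b + c := by
  -- With the sign of `a` adjusted, `y - b` has norm `2 - 2 + 1 = 1` and is orthogonal to `b`.
  obtain ⟨b, hb, hbb, hyb⟩ : ∃ b ∈ Z, b ⬝ᵥ b = 1 ∧ y ⬝ᵥ b = 1 := by
    rcases (AddSubgroup.eq_zero_or_one_or_neg_one hZ hy hyy.le ha haa).resolve_left hya with h | h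
    · exact ⟨a, ha, haa, h⟩
    · exact ⟨-a, Z.neg_mem ha, by simpa using haa, by simp [h]⟩
  have hc : y - b ∈ Z ∧ (y - b) ⬝ᵥ (y - b) = 1 := by
    refine ⟨Z.sub_mem hy hb, ?_⟩
    simp only [sub_dotProduct, dotProduct_sub]
    rw [dotProduct_comm b y, hyy, hbb, hyb]
    norm_num
  refine ⟨_, _, ?_, b, y - b, spans_mk ⟨hb, hbb⟩, spans_mk hc, by abel⟩
  intro he
  have h1 := spans_mk (Z := Z) ⟨hb, hbb⟩
  rw [he] at h1
  refine h1.dotProduct_ne_zero (spans_mk hc) ?_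
  rw [dotProduct_sub, dotProduct_comm b y, hyb, hbb, sub_self]

/-! ### From Gram vectors to the tree. -/

theorem SimpleGraph.Connected.isTreeLineGraphAtEndEdge_of_gram {V : Type*} [Fintype V]
    {H : SimpleGraph V} (hH : H.Connected) {v : V} {n : ℕ} (x : V → Fin n → ℝ)
    (hlin : LinearIndependent ℝ x) (hv : x v ⬝ᵥ x v = 1) (hx : ∀ w, w ≠ v → x w ⬝ᵥ x w = 2)
    (hint : ∀ u w, ∃ k : ℤ, x u ⬝ᵥ x w = k)
    (hadj : ∀ u w, u ≠ w → (x u ⬝ᵥ x w ≠ 0 ↔ H.Adj u w)) : H.IsTreeLineGraphAtEndEdge v := by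
  classical
  let Z : AddSubgroup (Fin n → ℝ) := AddSubgroup.closure (Set.range x)
  have hxZ : ∀ u, x u ∈ Z := fun u => AddSubgroup.subset_closure ⟨u, rfl⟩
  have hZ : ∀ y ∈ Z, ∀ z ∈ Z, ∃ k : ℤ, y ⬝ᵥ z = k := by
    intro y hy z hz
    induction hy, hz using AddSubgroup.closure_induction₂ with
    | mem _ _ hy hz =>
      obtain ⟨u, rfl⟩ := hy
      obtain ⟨w, rfl⟩ := hz
      exact hint u w
    | zero_left _ => exact ⟨0, by simp⟩
    | zero_right _ => exact ⟨0, by simp⟩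
    | add_left _ _ _ _ _ _ h1 h2 =>
      obtain ⟨k, hk⟩ := h1
      obtain ⟨l, hl⟩ := h2
      exact ⟨k + l, by simp [add_dotProduct, hk, hl]⟩
    | add_right _ _ _ _ _ _ h1 h2 =>
      obtain ⟨k, hk⟩ := h1
      obtain ⟨l, hl⟩ := h2
      exact ⟨k + l, by simp [dotProduct_add, hk, hl]⟩
    | neg_left _ _ _ _ h =>
      obtain ⟨k, hk⟩ := h
      exact ⟨-k, by simp [hk]⟩
    | neg_right _ _ _ _ h =>
      obtain ⟨k, hk⟩ := h
      exact ⟨-k, by simp [hk]⟩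
  have hdec : ∀ w, w ≠ v → ∃ q q' : Z.UnitLine, q ≠ q' ∧
      ∃ b c, Z.Spans (some q) b ∧ Z.Spans (some q') c ∧ x w = b + c := by
    -- A splitting spreads along an edge: `x w` cannot be orthogonal to every unit summand of its
    -- neighbour.
    have step : ∀ u w, H.Adj u w → w ≠ v → (u ≠ v → ∃ q q' : Z.UnitLine, q ≠ q' ∧
        ∃ b c, Z.Spans (some q) b ∧ Z.Spans (some q') c ∧ x u = b + c) →
        ∃ q q' : Z.UnitLine, q ≠ q' ∧
        ∃ b c, Z.Spans (some q) b ∧ Z.Spans (some q') c ∧ x w = b + c := by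
      intro u w huw hw hu
      have hne := (hadj w u huw.ne').2 huw.symm
      by_cases huv : u = v
      · exact AddSubgroup.exists_spans_add hZ (hxZ w) (hx w hw) (hxZ v) hv (huv ▸ hne)
      · obtain ⟨q, q', -, b, c, hb, hc, h⟩ := hu huv
        rw [h, dotProduct_add] at hne
        by_cases hwb : x w ⬝ᵥ b = 0
        · rw [hwb, zero_add] at hne
          exact AddSubgroup.exists_spans_add hZ (hxZ w) (hx w hw) hc.1.1 hc.1.2 hne
        · exact AddSubgroup.exists_spans_add hZ (hxZ w) (hx w hw) hb.1.1 hb.1.2 hwb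
    intro w
    obtain ⟨q⟩ := hH.preconnected w v
    induction q with
    | nil => exact fun h => absurd rfl h
    | cons hadj _ ih => exact fun hw => step _ _ hadj.symm hw (ih hv hx step)
  -- The unit vector `x v` is paired with the dummy line `none`, which becomes the leaf on the edge
  -- `v`.
  have hε : ∀ u, ∃ i j : Option Z.UnitLine, i ≠ j ∧ (i = none ↔ u = v) ∧ j ≠ none ∧
      ∃ a b, Z.Spans i a ∧ Z.Spans j b ∧ x u = a + b := by
    intro u
    by_cases hu : u = v
    · subst hu
      exact ⟨none, _, by simp, by simp, by simp, 0, x u, rfl, AddSubgroup.spans_mk ⟨hxZ u, hv⟩,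
        (zero_add _).symm⟩
    · obtain ⟨q, q', hq, h⟩ := hdec u hu
      exact ⟨some q, some q', by simpa using hq, by simp [hu], by simp, h⟩
  choose i j hij hi hj a b ha hb hab using hε
  let ε : V → Sym2 (Option Z.UnitLine) := fun u => s(i u, j u)
  have hspec : ∀ u k, k ∈ ε u → ∃ l c e, k ≠ l ∧ ε u = s(k, l) ∧ Z.Spans k c ∧ Z.Spans l e ∧
      x u = c + e := by
    intro u k hk
    rcases Sym2.mem_iff.1 hk with rfl | rfl
    · exact ⟨_, _, _, hij u, rfl, ha u, hb u, hab u⟩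
    · exact ⟨_, _, _, (hij u).symm, Sym2.eq_swap, hb u, ha u, by rw [hab u, add_comm]⟩
  have hroot : ∀ u, none ∈ ε u ↔ u = v := by
    intro u
    rw [Sym2.mem_iff, ← hi u]
    exact ⟨fun h => (h.resolve_right (hj u).symm).symm, fun h => Or.inl h.symm⟩
  have hshare : ∀ u (y : Fin n → ℝ), (∀ k ∈ ε u, ∀ c, Z.Spans k c → c ⬝ᵥ y = 0) →
      x u ⬝ᵥ y = 0 := by
    intro u y h
    rw [hab u, add_dotProduct, h _ (Sym2.mem_mk_left _ _) _ (ha u),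
      h _ (Sym2.mem_mk_right _ _) _ (hb u), add_zero]
  have hcov : ∀ k, ∃ u, k ∈ ε u := by
    rintro (_ | q)
    · exact ⟨v, (hroot v).2 rfl⟩
    -- A unit vector on an unused line would be orthogonal to all generators, hence to itself.
    · by_contra! hno
      have hq := AddSubgroup.spans_out q
      have h0 : ∀ y ∈ Z, y ⬝ᵥ q.out.1 = 0 := by
        intro y hy
        induction hy using AddSubgroup.closure_induction with
        | mem _ hy =>
          obtain ⟨u, rfl⟩ := hy
          refine hshare u _ fun k hk c hc => hc.dotProduct_eq_zero hZ hq ?_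
          rintro rfl
          exact hno u hk
        | zero => simp
        | add _ _ _ _ h1 h2 => rw [add_dotProduct, h1, h2, add_zero]
        | neg _ _ h => rw [neg_dotProduct, h, neg_zero]
      have := h0 _ hq.1.1
      rw [hq.dotProduct_self] at this
      exact one_ne_zero this
  have hfin := Sym2.finite_of_forall_exists_mem ε hcov
  have hfin' : Finite Z.UnitLine := Finite.of_injective some (Option.some_injective _)
  have := Fintype.ofFinite Z.UnitLine
  have hspan : ∀ k c, Z.Spans k c →
      c ∈ Submodule.span ℝ (Set.range fun q : Z.UnitLine => q.out.1) := by
    rintro (_ | q) c hc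
    · rw [show c = 0 from hc]
      exact Submodule.zero_mem _
    · have hq := Submodule.subset_span (R := ℝ)
        (Set.mem_range_self (f := fun q : Z.UnitLine => q.out.1) q)
      rcases (AddSubgroup.spans_out q).eq_or_eq_neg hc with rfl | rfl
      · exact hq
      · exact Submodule.neg_mem _ hq
  refine hH.isTreeLineGraphAtEndEdge ε (fun u => ?_) (fun u w huw => ?_) (fun u w huw hk => ?_)
    hcov ?_ hroot
  · rw [Sym2.mk_isDiag_iff]
    exact hij u
  · by_contra! hno
    refine (hadj u w huw.ne).2 huw (hshare u _ fun k hk c hc => ?_)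
    rw [dotProduct_comm]
    refine hshare w _ fun l hl e he => he.dotProduct_eq_zero hZ hc ?_
    rintro rfl
    exact hno _ hk hl
  · obtain ⟨k, hku, hkw⟩ := hk
    have hne : u ≠ w := fun h => huw (congrArg ε h)
    obtain ⟨l, c, e, hkl, hu, hc, he, hxu⟩ := hspec u k hku
    obtain ⟨l', c', e', hkl', hw, hc', he', hxw⟩ := hspec w k hkw
    -- With only one line in common nothing can cancel, unlike `a + b` against `a - b`.
    have hll : l ≠ l' := by
      rintro rfl
      exact huw (hu.trans hw.symm)
    rcases k with _ | q
    · exact absurd (((hroot u).1 hku).trans ((hroot w).1 hkw).symm) hne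
    · rw [← hadj u w hne, hxu, hxw, add_dotProduct, dotProduct_add, dotProduct_add,
        hc.dotProduct_eq_zero hZ he' hkl', he.dotProduct_eq_zero hZ hc' hkl.symm,
        he.dotProduct_eq_zero hZ he' hll, add_zero, add_zero, add_zero]
      exact hc.dotProduct_ne_zero hc'
  -- The independent vectors lie in the span of the unit lines, so there are at least `|V|` lines;
  -- `none` supplies the extra one.
  · rw [Nat.card_eq_fintype_card, Nat.card_eq_fintype_card, Fintype.card_option,
      add_le_add_iff_right, ← finrank_span_eq_card hlin]
    refine (Submodule.finrank_mono (Submodule.span_le.2 ?_)).trans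
      (finrank_range_le_card (R := ℝ) fun q : Z.UnitLine => q.out.1)
    rintro _ ⟨u, rfl⟩
    rw [hab u]
    exact Submodule.add_mem _ (hspan _ _ (ha u)) (hspan _ _ (hb u))

theorem EdgeSignedGraph.isTreeLineGraphAtEndEdge {V : Type*} [Fintype V] (G : EdgeSignedGraph V)
    (hconn : G.underlying.Connected) (v : V) (hv : -2 < smallestEigenvalue (G.modAdjMatrix v)) :
    G.underlying.IsTreeLineGraphAtEndEdge v := by
  classical
  have : Nonempty V := ⟨v⟩
  have hpos := (lt_smallestEigenvalue_iff (G.modAdjMatrix_isHermitian v) _).1 hv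
  set M : Matrix V V ℝ := G.modAdjMatrix v + (2 : ℝ) • 1 with hMdef
  have hMx : ∀ x : V → ℝ, x ⬝ᵥ (M *ᵥ x) = x ⬝ᵥ (G.modAdjMatrix v *ᵥ x) + 2 * (x ⬝ᵥ x) := by
    intro x
    rw [hMdef, add_mulVec, smul_mulVec, one_mulVec, dotProduct_add, dotProduct_smul, smul_eq_mul]
  have hM : M.PosDef := by
    refine PosDef.of_dotProduct_mulVec_pos ?_ fun x hx => ?_
    · exact (G.modAdjMatrix_isHermitian v).add (by simp [Matrix.IsHermitian])
    · have := hpos x hx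
      rw [star_trivial, hMx]
      linarith
  -- Transposing a sum of rank-one terms gives the Gram vectors.
  obtain ⟨m, y, hy⟩ := posSemidef_iff_eq_sum_vecMulVec.1 hM.posSemidef
  let x : V → Fin m → ℝ := fun u i => y i u
  have hx : ∀ u w, x u ⬝ᵥ x w = M u w := by
    intro u w
    rw [hy, Matrix.sum_apply]
    simp [x, dotProduct, vecMulVec_apply]
  have hne : ∀ u w, u ≠ w → x u ⬝ᵥ x w = G.adjMatrix u w := by
    intro u w huw
    have : ¬ (u = v ∧ w = v) := fun h => huw (h.1.trans h.2.symm)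
    simp [hx, hMdef, modAdjMatrix, this, huw]
  have hxv : x v ⬝ᵥ x v = 1 := by
    rw [hx]
    norm_num [hMdef, modAdjMatrix]
  have hxw : ∀ w, w ≠ v → x w ⬝ᵥ x w = 2 := by
    intro w hw
    simp [hx, hMdef, modAdjMatrix, hw, adjMatrix_self]
  refine hconn.isTreeLineGraphAtEndEdge_of_gram x ?_ hxv hxw (fun u w => ?_) fun u w huw => ?_
  · rw [Fintype.linearIndependent_iff]
    intro c hc
    have hMc : M *ᵥ c = 0 := by
      funext u
      have h1 : (M *ᵥ c) u = x u ⬝ᵥ ∑ w, c w • x w := by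
        rw [dotProduct_sum, mulVec, dotProduct]
        refine Finset.sum_congr rfl fun w _ => ?_
        rw [dotProduct_smul, hx, smul_eq_mul, mul_comm]
      rw [h1, hc, dotProduct_zero, Pi.zero_apply]
    by_contra! hne
    obtain ⟨i, hi⟩ := hne
    have := hM.dotProduct_mulVec_pos (x := c) (fun h => hi (congrFun h i))
    rw [hMc, dotProduct_zero] at this
    exact this.false
  · by_cases huw : u = w
    · subst huw
      by_cases hu : u = v
      · exact ⟨1, by simp [hu, hxv]⟩
      · exact ⟨2, by simp [hxw u hu]⟩
    · rw [hne u w huw]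
      exact G.exists_int_adjMatrix u w
  · rw [hne u w huw]
    exact EdgeSignedGraph.adjMatrix_ne_zero_iff

theorem mainTheorem2 {V : Type*} [Fintype V] (G : EdgeSignedGraph V)
    (hconn : G.underlying.Connected) (hG : -2 < smallestEigenvalue G.adjMatrix) (v : V) :
    smallestEigenvalue (G.modAdjMatrix v) < smallestEigenvalue G.adjMatrix ∧
    (-2 < smallestEigenvalue (G.modAdjMatrix v) ↔ G.underlying.IsTreeLineGraphAtEndEdge v) ∧
    (¬ G.underlying.IsTreeLineGraphAtEndEdge v → smallestEigenvalue (G.modAdjMatrix v) ≤ -2) := by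
  have hiff : -2 < smallestEigenvalue (G.modAdjMatrix v) ↔
      G.underlying.IsTreeLineGraphAtEndEdge v := by
    refine ⟨G.isTreeLineGraphAtEndEdge hconn v, fun h => ?_⟩
    obtain ⟨p, d, hp⟩ := h.exists_isParentMap
    exact EdgeSignedGraph.neg_two_lt_smallestEigenvalue_modAdjMatrix hG hp
  refine ⟨?_, hiff, fun h => not_lt.1 (mt hiff.1 h)⟩
  by_cases h : G.underlying.IsTreeLineGraphAtEndEdge v
  · obtain ⟨p, d, hp⟩ := h.exists_isParentMap
    exact EdgeSignedGraph.smallestEigenvalue_modAdjMatrix_lt hG hp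
  -- Outside the tree case `-2` already separates the two eigenvalues.
  · exact (not_lt.1 (mt hiff.1 h)).trans_lt hG
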